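/- Let $G$ be a finite simple graph with vertex set $V$, $|V|=n$, let $x\ne y$ be vertices of $G$, and let $\mathcal K$ be an induced subgraph of $G$ containing $x$ and $y$. Put $$X=N_x(G)\setminus\bigl(V(\mathcal K)\cup N_y(G)\bigr),\qquad Y=N_y(G)\setminus\bigl(V(\mathcal K)\cup N_x(G)\bigr),$$ and write $[z,Z]=\{zv: v\in Z\}$. The graph $$G'=\mathcal K_{xy}(G)=\bigl(G-[x,X]\bigr)\cup[y,X]$$ is said to be obtained from $G$ by the $\mathcal K_{xy}$-operation. The operation is called symmetric if the graph $G-([x,X]\cup[y,Y])$ has an automorphism $\alpha:V\to V$ such that $\alpha(x)=y$, $\alpha(y)=x$, $\alpha(V(\mathcal K))=V(\mathcal K)$, and $\alpha(v)=v$ for every $v\in X\cup Y$. For a graph $H$ with $n \geq 1$ vertices let $L(H)=D(H)-A(H)$ be its Laplacian matrix, and let $P(\lambda,H)$ be its Laplacian polynomial, that is, the polynomial of degree $n-1$ with $\lambda P(\lambda,H)=\det(\lambda I-L(H))$. For graphs $G$, $F$ with $v(G)=v(F)=n$ write $G\succeq^p F$ if $P(\lambda,G)\ge P(\lambda,F)$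 for every real $\lambda\ge n$. Theorem. If $G'$ is obtained from $G$ by a symmetric $\mathcal K_{xy}$-operation, then $G\succeq^p G'$. -/

import Mathlib

namespace LaplacianPosets

open Polynomial

/-- The Laplacian polynomial `P(λ, G)` of a finite simple graph `G`: the quotient of the
characteristic polynomial `det (λ I - L(G))` of the Laplacian matrix `L(G) = D(G) - A(G)` by `λ`
(the division is exact, see `X_mul_laplacianPoly`). -/
noncomputable def laplacianPoly {V : Type*} [Fintype V] (G : SimpleGraph V) : ℝ[X] := by
  classical exact (G.lapMatrix ℝ).charpoly.divX

/-- `λ P(λ, G) = det (λ I - L(G))`. -/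
theorem X_mul_laplacianPoly {V : Type*} [Fintype V] [Nonempty V] [DecidableEq V]
    (G : SimpleGraph V) [DecidableRel G.Adj] :
    X * laplacianPoly G = (G.lapMatrix ℝ).charpoly := by
  have h0 : (G.lapMatrix ℝ).charpoly.coeff 0 = 0 := by
    have hdet := Matrix.det_eq_sign_charpoly_coeff (G.lapMatrix ℝ)
    rw [SimpleGraph.det_lapMatrix_eq_zero] at hdet
    have hne : (-1 : ℝ) ^ Fintype.card V ≠ 0 := pow_ne_zero _ (by norm_num)
    exact (mul_eq_zero.mp hdet.symm).resolve_left hne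
  have h := Polynomial.X_mul_divX_add (G.lapMatrix ℝ).charpoly
  rw [h0, C_0, add_zero] at h
  rw [← h]
  unfold laplacianPoly
  congr!

/-- The relation `G ⪰ᵖ_s F`: `s ≥ v(G) = v(F)` and `P(λ, G) ≥ P(λ, F)` for every real `λ ≥ s`. -/
def PGeFrom {V W : Type*} [Fintype V] [Fintype W] (s : ℝ)
    (G : SimpleGraph V) (F : SimpleGraph W) : Prop :=
  (Fintype.card V : ℝ) ≤ s ∧ Fintype.card V = Fintype.card W ∧
    ∀ t : ℝ, s ≤ t → (laplacianPoly F).eval t ≤ (laplacianPoly G).eval t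

/-- The relation `G ⪰ᵖ F`, that is `G ⪰ᵖ_n F` with `n = v(G) = v(F)`. -/
def PGe {V W : Type*} [Fintype V] [Fintype W] (G : SimpleGraph V) (F : SimpleGraph W) : Prop :=
  PGeFrom (Fintype.card V : ℝ) G F

/-- `N_x(G) \ (K ∪ N_y(G))`: this is the set `X` for the pair `(x, y)` and the set `Y` for
the pair `(y, x)`; `K` is the vertex set of the induced subgraph `𝒦`. -/
def privateNeighbors {V : Type*} (G : SimpleGraph V) (K : Set V) (x y : V) : Set V :=
  G.neighborSet x \ (K ∪ G.neighborSet y)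

/-- `[x, X] = {xv : v ∈ X}`. -/
def edgesTo {V : Type*} (x : V) (X : Set V) : Set (Sym2 V) :=
  {e | ∃ v ∈ X, e = s(x, v)}

/-- `𝒦_{xy}(G) = (G - [x, X]) ∪ [y, X]`, where `K` is the vertex set of the induced
subgraph `𝒦` and `X = N_x(G) \ (K ∪ N_y(G))`. -/
def kOp {V : Type*} (G : SimpleGraph V) (K : Set V) (x y : V) : SimpleGraph V :=
  G.deleteEdges (edgesTo x (privateNeighbors G K x y)) ⊔
    SimpleGraph.fromEdgeSet (edgesTo y (privateNeighbors G K x y))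

/-- `G - ([x, X] ∪ [y, Y])`. -/
def kCore {V : Type*} (G : SimpleGraph V) (K : Set V) (x y : V) : SimpleGraph V :=
  G.deleteEdges
    (edgesTo x (privateNeighbors G K x y) ∪ edgesTo y (privateNeighbors G K y x))

/-- The `𝒦_{xy}`-operation on `G` is symmetric: `G - ([x, X] ∪ [y, Y])` has an automorphism that
swaps `x` and `y`, maps `K` onto itself and fixes every vertex of `X ∪ Y`. -/
def IsSymmetricKOp {V : Type*} (G : SimpleGraph V) (K : Set V) (x y : V) : Prop :=
  ∃ α : kCore G K x y ≃g kCore G K x y,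
    α x = y ∧ α y = x ∧ α '' K = K ∧
      ∀ v ∈ privateNeighbors G K x y ∪ privateNeighbors G K y x, α v = v

/-- `G'` is obtained from `G` by a symmetric `𝒦_{xy}`-operation, for some distinct vertices
`x`, `y` and some induced subgraph `𝒦` (with vertex set `K`) containing both. -/
def ObtainedBySymmetricKOp {V : Type*} (G G' : SimpleGraph V) : Prop :=
  ∃ (K : Set V) (x y : V), x ≠ y ∧ x ∈ K ∧ y ∈ K ∧ IsSymmetricKOp G K x y ∧ G' = kOp G K x y

end LaplacianPosets

/-! Write H for the symmetric core, so that G is H with stars x–X and y–Y, and G' is H with stars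
y–X and y–Y. Both are compared with the α-invariant average W of G and its image under α. Put A = t
- L(W), d = e_x - e_y, and let p, q be the `midFlow` vectors of X, Y. Then t - L(G) and t - L(G')
differ from A by symmetric rank-two terms built from d and p - q, respectively d and p + q
(`weightedLap_starWeight_sub`). Since α fixes p and q and negates d, the cross pairings under A⁻¹
vanish, and `det_add_smul_vecMulVec` gives a determinant difference of det A · ⟨p, A⁻¹q⟩ · ⟨d,
A⁻¹d⟩. For t > n, A is positive definite, so only ⟨p, A⁻¹q⟩ ≥ 0 remains. A maximum principle puts
the maximum of A⁻¹q at x or y, hence by symmetry at both, and p pairs nonnegatively with such a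
vector. The case t = n follows by continuity. -/

namespace LaplacianPosets

open Polynomial Matrix

/-! ### Weighted Laplacians, the maximum principle and stars. -/

section Weighted

variable {V : Type*} [Fintype V] [DecidableEq V]

/-- The Laplacian matrix of a weighted graph with weight matrix `W`. -/
noncomputable def weightedLap (W : Matrix V V ℝ) : Matrix V V ℝ :=
  diagonal (W *ᵥ 1) - W

theorem weightedLap_add (W W' : Matrix V V ℝ) :
    weightedLap (W + W') = weightedLap W + weightedLap W' := by
  ext i j
  by_cases h : i = j
  · subst h
    simp only [weightedLap, add_mulVec, Matrix.sub_apply, Matrix.add_apply, diagonal_apply_eq,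
      Pi.add_apply]
    ring
  · simp only [weightedLap, Matrix.sub_apply, Matrix.add_apply, diagonal_apply_ne _ h]
    ring

theorem weightedLap_smul (c : ℝ) (W : Matrix V V ℝ) :
    weightedLap (c • W) = c • weightedLap W := by
  simp only [weightedLap, smul_mulVec, smul_sub, diagonal_smul]

theorem weightedLap_sum {ι : Type*} (s : Finset ι) (W : ι → Matrix V V ℝ) :
    weightedLap (∑ i ∈ s, W i) = ∑ i ∈ s, weightedLap (W i) := by
  classical
  induction s using Finset.induction_on with
  | empty => ext i j; simp [weightedLap, zero_mulVec]
  | insert a s ha ih => rw [Finset.sum_insert ha, Finset.sum_insert ha, weightedLap_add, ih]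

theorem weightedLap_adjMatrix (G : SimpleGraph V) [DecidableRel G.Adj] :
    weightedLap (G.adjMatrix ℝ) = G.lapMatrix ℝ := by
  ext i j
  simp [weightedLap, SimpleGraph.lapMatrix, SimpleGraph.degMatrix, diagonal_apply,
    SimpleGraph.adjMatrix_mulVec_apply]

theorem weightedLap_mulVec_apply (W : Matrix V V ℝ) (φ : V → ℝ) (i : V) :
    (weightedLap W *ᵥ φ) i = ∑ j, W i j * (φ i - φ j) := by
  simp only [weightedLap, sub_mulVec, Pi.sub_apply, mulVec_diagonal, mul_sub,
    Finset.sum_sub_distrib]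
  simp [mulVec, dotProduct, Finset.sum_mul]

theorem weightedLap_submatrix (W : Matrix V V ℝ) (α : Equiv.Perm V)
    (hW : W.submatrix α α = W) : (weightedLap W).submatrix α α = weightedLap W := by
  have h (i j : V) : W (α i) (α j) = W i j := congrFun (congrFun hW i) j
  ext i j
  have hs : ∑ k, W (α i) k = ∑ k, W i k := by
    rw [← Equiv.sum_comp α]
    exact Finset.sum_congr rfl fun k _ => h i k
  simp [weightedLap, diagonal_apply, mulVec, dotProduct, h, hs]

theorem isSymm_weightedLap {W : Matrix V V ℝ} (hW : W.IsSymm) : (weightedLap W).IsSymm := by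
  unfold weightedLap
  exact (isSymm_diagonal _).sub hW

theorem dotProduct_weightedLap {W : Matrix V V ℝ} (hW : W.IsSymm) (φ : V → ℝ) :
    2 * (φ ⬝ᵥ weightedLap W *ᵥ φ) = ∑ i, ∑ j, W i j * (φ i - φ j) ^ 2 := by
  have h1 : φ ⬝ᵥ weightedLap W *ᵥ φ = ∑ i, ∑ j, W i j * (φ i * (φ i - φ j)) := by
    simp only [dotProduct, weightedLap_mulVec_apply, Finset.mul_sum]
    exact Finset.sum_congr rfl fun i _ => Finset.sum_congr rfl fun j _ => by ring
  have h2 : φ ⬝ᵥ weightedLap W *ᵥ φ = ∑ i, ∑ j, W i j * (φ j * (φ j - φ i)) := by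
    rw [h1, Finset.sum_comm]
    exact Finset.sum_congr rfl fun i _ => Finset.sum_congr rfl fun j _ => by rw [hW.apply]
  rw [two_mul]
  nth_rewrite 1 [h1]
  rw [h2, ← Finset.sum_add_distrib]
  refine Finset.sum_congr rfl fun i _ => ?_
  rw [← Finset.sum_add_distrib]
  exact Finset.sum_congr rfl fun j _ => by ring

omit [DecidableEq V] in
theorem sum_sum_sub_sq (φ : V → ℝ) :
    ∑ i, ∑ j, (φ i - φ j) ^ 2 = 2 * Fintype.card V * (φ ⬝ᵥ φ) - 2 * (∑ i, φ i) ^ 2 := by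
  have h (i j : V) : (φ i - φ j) ^ 2 = φ i * φ i + φ j * φ j - 2 * (φ i * φ j) := by ring
  simp only [h, Finset.sum_add_distrib, Finset.sum_sub_distrib, Finset.sum_const,
    Finset.card_univ, nsmul_eq_mul, ← Finset.mul_sum, dotProduct, ← Finset.sum_mul]
  ring

/-- The shifted Laplacian `t - L` is positive definite for `t > n` when all weights are at most
one. -/
theorem posDef_sub_weightedLap {W : Matrix V V ℝ} (hW : W.IsSymm) (h1 : ∀ i j, W i j ≤ 1)
    {t : ℝ} (ht : (Fintype.card V : ℝ) < t) :
    (t • (1 : Matrix V V ℝ) - weightedLap W).PosDef := by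
  refine PosDef.of_dotProduct_mulVec_pos ?_ fun φ hφ => ?_
  · have := (isSymm_weightedLap hW).eq
    rw [IsHermitian, conjTranspose_eq_transpose_of_trivial, transpose_sub, transpose_smul,
      transpose_one, this]
  -- Compare with the complete graph, whose Laplacian form is at most n|φ|².
  · have hle : ∑ i, ∑ j, W i j * (φ i - φ j) ^ 2 ≤ ∑ i, ∑ j, (φ i - φ j) ^ 2 :=
      Finset.sum_le_sum fun i _ => Finset.sum_le_sum fun j _ =>
        mul_le_of_le_one_left (sq_nonneg _) (h1 i j)
    rw [← dotProduct_weightedLap hW, sum_sum_sub_sq] at hle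
    have hpos : 0 < φ ⬝ᵥ φ := by
      simpa using dotProduct_star_self_pos_iff.mpr hφ
    have := mul_pos (sub_pos.mpr ht) hpos
    simp only [star_trivial, sub_mulVec, smul_mulVec, one_mulVec, dotProduct_sub,
      dotProduct_smul, smul_eq_mul]
    nlinarith [sq_nonneg (∑ i, φ i)]

/-- Maximum principle: if `(t - L) φ = f` where `f` has zero sum and is nonpositive away from `s`,
then `φ` attains its maximum on `s`, or is zero. -/
theorem exists_mem_forall_le_of_mulVec_eq [Nonempty V] {W : Matrix V V ℝ} (hW : W.IsSymm)
    (h1 : ∀ i j, W i j ≤ 1) {t : ℝ} (ht : (Fintype.card V : ℝ) < t) {φ f : V → ℝ}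
    (hφ : (t • (1 : Matrix V V ℝ) - weightedLap W) *ᵥ φ = f) (hf : ∑ i, f i = 0)
    {s : Set V} (hs : s.Nonempty) (hfs : ∀ i ∉ s, f i ≤ 0) : ∃ i ∈ s, ∀ j, φ j ≤ φ i := by
  have hφi (i : V) : t * φ i - ∑ j, W i j * (φ i - φ j) = f i := by
    rw [← weightedLap_mulVec_apply, ← hφ]
    simp [sub_mulVec, smul_mulVec]
  have hsum : ∑ i, φ i = 0 := by
    have hz : ∑ i, ∑ j, W i j * (φ i - φ j) = 0 := by
      have : ∑ i, ∑ j, W i j * (φ i - φ j) = -∑ i, ∑ j, W i j * (φ i - φ j) := by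
        conv_lhs => rw [Finset.sum_comm]
        rw [← Finset.sum_neg_distrib]
        refine Finset.sum_congr rfl fun i _ => ?_
        rw [← Finset.sum_neg_distrib]
        exact Finset.sum_congr rfl fun j _ => by rw [hW.apply]; ring
      linarith
    have : t * ∑ i, φ i = 0 := by
      rw [← hf, ← Finset.sum_congr rfl fun i _ => hφi i, Finset.sum_sub_distrib, hz,
        Finset.mul_sum, sub_zero]
    have ht0 : (0 : ℝ) < t := lt_of_le_of_lt (Nat.cast_nonneg _) ht
    exact (mul_eq_zero.mp this).resolve_left ht0.ne'
  obtain ⟨i, hi⟩ := Finite.exists_max φ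
  by_cases hle : φ i ≤ 0
  · have hzero : ∀ j, φ j = 0 := fun j =>
      (Finset.sum_eq_zero_iff_of_nonpos fun k _ => (hi k).trans hle).mp hsum j (Finset.mem_univ j)
    obtain ⟨a, ha⟩ := hs
    exact ⟨a, ha, fun j => by rw [hzero, hzero]⟩
  · refine ⟨i, ?_, hi⟩
    by_contra his
    -- At a positive maximum outside `s` the equation would give t φ i ≤ n φ i, contradicting t > n.
    have hc : ∑ j, (φ i - φ j) = Fintype.card V * φ i := by
      simp [Finset.sum_sub_distrib, hsum]
    have hb : ∑ j, W i j * (φ i - φ j) ≤ ∑ j, (φ i - φ j) :=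
      Finset.sum_le_sum fun j _ => mul_le_of_le_one_left (sub_nonneg.mpr (hi j)) (h1 i j)
    have := mul_pos (sub_pos.mpr ht) (not_le.mp hle)
    linarith [hφi i, hfs i his]

/-- The weight matrix of the star with centre `a` and set of leaves `S`. -/
noncomputable def starWeight (a : V) (S : Finset V) : Matrix V V ℝ :=
  ∑ v ∈ S, (vecMulVec (Pi.single a 1) (Pi.single v 1) + vecMulVec (Pi.single v 1) (Pi.single a 1))

omit [Fintype V] in
theorem starWeight_apply (a : V) (S : Finset V) (i j : V) :
    starWeight a S i j =
      (if i = a ∧ j ∈ S then 1 else 0) + (if j = a ∧ i ∈ S then 1 else 0) := by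
  simp [starWeight, Matrix.sum_apply, vecMulVec_apply, Pi.single_apply, Finset.sum_add_distrib,
    ite_and]
  split_ifs <;> rfl

omit [Fintype V] in
theorem starWeight_submatrix (α : Equiv.Perm V) {a b : V} (hab : α a = b) {S : Finset V}
    (hS : ∀ v ∈ S, α v = v) : (starWeight b S).submatrix α α = starWeight a S := by
  have h1 (i : V) : α i = b ↔ i = a := by rw [← hab, α.injective.eq_iff]
  have h2 (i : V) : α i ∈ S ↔ i ∈ S :=
    ⟨fun h => α.injective (hS _ h) ▸ h, fun h => (hS i h).symm ▸ h⟩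
  ext i j
  simp [starWeight_apply, h1, h2]

theorem weightedLap_starWeight {a : V} {S : Finset V} (ha : a ∉ S) :
    weightedLap (starWeight a S) =
      ∑ v ∈ S, vecMulVec (Pi.single a 1 - Pi.single v 1) (Pi.single a 1 - Pi.single v 1) := by
  rw [starWeight, weightedLap_sum]
  refine Finset.sum_congr rfl fun v hv => ?_
  have hav : a ≠ v := fun h => ha (h ▸ hv)
  ext i j
  simp only [weightedLap, Matrix.sub_apply, Matrix.add_apply, diagonal_apply, mulVec, dotProduct,
    vecMulVec_apply, Pi.one_apply, mul_one, Finset.sum_add_distrib, ← Finset.mul_sum,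
    Pi.sub_apply, Pi.single_apply, Finset.sum_ite_eq', Finset.mem_univ, if_true]
  grind

/-- The vector `∑_{v ∈ S} ((e_x + e_y) / 2 - e_v)`. -/
noncomputable def midFlow (x y : V) (S : Finset V) : V → ℝ :=
  ∑ v ∈ S, ((1 / 2 : ℝ) • (Pi.single x 1 + Pi.single y 1) - Pi.single v 1)

/-- Termwise this is aaᵀ - bbᵀ = mdᵀ + dmᵀ with m = (a + b)/2 and d = a - b, where a = e_x - e_v and
b = e_y - e_v; here d does not depend on v. -/
theorem weightedLap_starWeight_sub {x y : V} {S : Finset V} (hx : x ∉ S) (hy : y ∉ S) :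
    weightedLap (starWeight x S) - weightedLap (starWeight y S) =
      vecMulVec (midFlow x y S) (Pi.single x 1 - Pi.single y 1) +
        vecMulVec (Pi.single x 1 - Pi.single y 1) (midFlow x y S) := by
  rw [weightedLap_starWeight hx, weightedLap_starWeight hy, ← Finset.sum_sub_distrib]
  ext i j
  simp only [Matrix.sum_apply, Matrix.add_apply, Matrix.sub_apply, vecMulVec_apply, midFlow, Finset.sum_apply,
    Finset.sum_mul, Finset.mul_sum, Pi.sub_apply, Pi.smul_apply, Pi.add_apply, smul_eq_mul]
  rw [← Finset.sum_add_distrib]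
  exact Finset.sum_congr rfl fun v _ => by ring

omit [Fintype V] in
theorem midFlow_comp (α : Equiv.Perm V) {x y : V} (hx : α x = y) (hy : α y = x) {S : Finset V}
    (hS : ∀ v ∈ S, α v = v) : midFlow x y S ∘ α = midFlow x y S := by
  have h1 (i : V) : α i = y ↔ i = x := by rw [← hx, α.injective.eq_iff]
  have h2 (i : V) : α i = x ↔ i = y := by rw [← hy, α.injective.eq_iff]
  ext i
  simp only [midFlow, Function.comp_apply, Finset.sum_apply]
  refine Finset.sum_congr rfl fun v hv => ?_
  have h3 : α i = v ↔ i = v :=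
    ⟨fun h => α.injective (h.trans (hS v hv).symm), fun h => by rw [h, hS v hv]⟩
  simp only [Pi.sub_apply, Pi.smul_apply, Pi.add_apply, Pi.single_apply, h1, h2, h3]
  ring

theorem sum_midFlow (x y : V) (S : Finset V) : ∑ i, midFlow x y S i = 0 := by
  simp only [midFlow, Finset.sum_apply]
  rw [Finset.sum_comm]
  refine Finset.sum_eq_zero fun v _ => ?_
  simp [Finset.sum_sub_distrib, Finset.sum_add_distrib, ← Finset.mul_sum]
  norm_num

omit [Fintype V] in
theorem midFlow_nonpos {x y : V} (S : Finset V) {i : V} (hx : i ≠ x) (hy : i ≠ y) :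
    midFlow x y S i ≤ 0 := by
  simp only [midFlow, Finset.sum_apply]
  refine Finset.sum_nonpos fun v _ => ?_
  simp only [Pi.sub_apply, Pi.smul_apply, Pi.add_apply, Pi.single_apply, hx, hy, if_false]
  split_ifs <;> norm_num

/-- When φ x = φ y the pairing is the sum of φ x - φ v over `S`. -/
theorem midFlow_dotProduct_nonneg {x y : V} (S : Finset V) {φ : V → ℝ} (hxy : φ x = φ y)
    (hmax : ∀ j, φ j ≤ φ x) : 0 ≤ midFlow x y S ⬝ᵥ φ := by
  rw [midFlow, sum_dotProduct]
  refine Finset.sum_nonneg fun v _ => ?_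
  simp only [sub_dotProduct, smul_dotProduct, add_dotProduct, single_dotProduct, smul_eq_mul]
  linarith [hmax v]

end Weighted

/-! ### Rank-two determinant updates and permutation invariance. -/

section LinearAlgebra

variable {V : Type*} [Fintype V] [DecidableEq V]

/-- The matrix determinant lemma reduces this to a 2 × 2 determinant whose diagonal entries are 1,
because the cross pairings vanish. -/
theorem det_add_smul_vecMulVec {A : Matrix V V ℝ} (hA : IsUnit A.det) (c : ℝ) {u v : V → ℝ}
    (huv : u ⬝ᵥ A⁻¹ *ᵥ v = 0) (hvu : v ⬝ᵥ A⁻¹ *ᵥ u = 0) :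
    (A + c • (vecMulVec u v + vecMulVec v u)).det =
      A.det * (1 - c ^ 2 * ((u ⬝ᵥ A⁻¹ *ᵥ u) * (v ⬝ᵥ A⁻¹ *ᵥ v))) := by
  have h : c • (vecMulVec u v + vecMulVec v u) =
      (Matrix.of ![u, v])ᵀ * Matrix.of ![c • v, c • u] := by
    ext i j
    simp [Matrix.mul_apply, Fin.sum_univ_two, vecMulVec_apply]
    ring
  have hentry (a b : Fin 2) :
      (Matrix.of ![c • v, c • u] * A⁻¹ * (Matrix.of ![u, v])ᵀ) a b =
        (![c • v, c • u] a) ⬝ᵥ A⁻¹ *ᵥ (![u, v] b) := by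
    rw [Matrix.mul_assoc]
    rfl
  rw [h, det_add_mul _ _ hA, det_fin_two]
  simp only [Matrix.add_apply, hentry]
  simp only [cons_val_zero, cons_val_one, smul_dotProduct, smul_eq_mul, huv, hvu, one_apply_eq,
    one_apply_ne zero_ne_one, one_apply_ne one_ne_zero]
  ring

omit [DecidableEq V] in
theorem dotProduct_mulVec_comp {A : Matrix V V ℝ} (α : Equiv.Perm V)
    (hA : A.submatrix α α = A) (u v : V → ℝ) :
    (u ∘ α) ⬝ᵥ A *ᵥ (v ∘ α) = u ⬝ᵥ A *ᵥ v := by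
  nth_rewrite 1 [← hA]
  rw [submatrix_mulVec_equiv, Function.comp_assoc, Equiv.self_comp_symm, Function.comp_id,
    comp_equiv_dotProduct_comp_equiv]

omit [DecidableEq V] in
theorem mulVec_comp_of_submatrix {A : Matrix V V ℝ} (α : Equiv.Perm V)
    (hA : A.submatrix α α = A) {v : V → ℝ} (hv : v ∘ α = v) : (A *ᵥ v) ∘ α = A *ᵥ v := by
  nth_rewrite 2 [← hA]
  nth_rewrite 2 [← hv]
  rw [submatrix_mulVec_equiv, Function.comp_assoc, Equiv.self_comp_symm, Function.comp_id]

end LinearAlgebra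

/-! ### The determinant inequality. -/

/-- The comparison of two weighted graphs obtained from a symmetric one by attaching stars. -/
theorem det_le_det_of_symmetric_stars {V : Type*} [Fintype V] [DecidableEq V]
    {H : Matrix V V ℝ} (hH : H.IsSymm) {x y : V} {X Y : Finset V}
    (hxX : x ∉ X) (hyX : y ∉ X) (hxY : x ∉ Y) (hyY : y ∉ Y) (α : Equiv.Perm V)
    (hHα : H.submatrix α α = H) (hαx : α x = y) (hαy : α y = x)
    (hαX : ∀ v ∈ X, α v = v) (hαY : ∀ v ∈ Y, α v = v)
    (hle : ∀ i j, (H + starWeight x X + starWeight y Y) i j ≤ 1)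
    {t : ℝ} (ht : (Fintype.card V : ℝ) < t) :
    (t • (1 : Matrix V V ℝ) - weightedLap (H + starWeight y X + starWeight y Y)).det ≤
      (t • (1 : Matrix V V ℝ) - weightedLap (H + starWeight x X + starWeight y Y)).det := by
  have : Nonempty V := ⟨x⟩
  set B := H + starWeight x X + starWeight y Y with hB
  have hBα : B.submatrix α α = H + starWeight y X + starWeight x Y := by
    rw [hB, submatrix_add, submatrix_add]
    simp only [Pi.add_apply, hHα, starWeight_submatrix α hαy hαX, starWeight_submatrix α hαx hαY]
  have hBα2 : (B.submatrix α α).submatrix α α = B := by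
    rw [hBα, hB, submatrix_add, submatrix_add]
    simp only [Pi.add_apply, hHα, starWeight_submatrix α hαx hαX, starWeight_submatrix α hαy hαY]
  set W := (1 / 2 : ℝ) • (B + B.submatrix α α) with hW
  have hstar (a : V) (S : Finset V) : (starWeight a S).IsSymm := by
    ext i j
    simp only [transpose_apply, starWeight_apply]
    ring
  have hBs : B.IsSymm := (hH.add (hstar _ _)).add (hstar _ _)
  have hWs : W.IsSymm := (hBs.add (hBs.submatrix α)).smul _
  have hW1 (i j : V) : W i j ≤ 1 := by
    simp only [hW, Matrix.smul_apply, Matrix.add_apply, submatrix_apply, smul_eq_mul]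
    linarith [hle i j, hle (α i) (α j)]
  have hWα : W.submatrix α α = W := by
    ext i j
    have := congrFun (congrFun hBα2 i) j
    simp only [submatrix_apply] at this
    simp only [hW, submatrix_apply, Matrix.smul_apply, Matrix.add_apply, this]
    rw [add_comm]
  set A := t • (1 : Matrix V V ℝ) - weightedLap W with hA
  have hpd : A.PosDef := posDef_sub_weightedLap hWs hW1 ht
  have hdet : IsUnit A.det := hpd.det_pos.ne'.isUnit
  have hAα : A.submatrix α α = A := by
    rw [hA, submatrix_sub, Pi.sub_apply, Pi.sub_apply, weightedLap_submatrix W α hWα,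
      submatrix_smul, Pi.smul_apply, Pi.smul_apply, submatrix_one_equiv]
  have hIα : A⁻¹.submatrix α α = A⁻¹ := by rw [← inv_submatrix_equiv, hAα]
  have hIs : A⁻¹.IsSymm := by
    have := hpd.inv.isHermitian
    rwa [IsHermitian, conjTranspose_eq_transpose_of_trivial] at this
  have hcomm (u v : V → ℝ) : u ⬝ᵥ A⁻¹ *ᵥ v = v ⬝ᵥ A⁻¹ *ᵥ u := by
    rw [dotProduct_mulVec, ← mulVec_transpose, hIs.eq, dotProduct_comm]
  set d : V → ℝ := Pi.single x 1 - Pi.single y 1 with hd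
  have hdα : d ∘ α = -d := by
    have h1 (i : V) : α i = y ↔ i = x := by rw [← hαx, α.injective.eq_iff]
    have h2 (i : V) : α i = x ↔ i = y := by rw [← hαy, α.injective.eq_iff]
    ext i
    simp [hd, Pi.single_apply, h1, h2]
  set p := midFlow x y X with hp
  set q := midFlow x y Y with hq
  have hpα : p ∘ α = p := midFlow_comp α hαx hαy hαX
  have hqα : q ∘ α = q := midFlow_comp α hαx hαy hαY
  -- Applying α leaves `u` and `A⁻¹` alone but negates `d`, so the pairing equals its own negative.
  have horth {u : V → ℝ} (hu : u ∘ α = u) : u ⬝ᵥ A⁻¹ *ᵥ d = 0 := by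
    have := dotProduct_mulVec_comp α hIα u d
    rw [hu, hdα, mulVec_neg, dotProduct_neg] at this
    linarith
  have hpq : 0 ≤ p ⬝ᵥ A⁻¹ *ᵥ q := by
    have hφ : A *ᵥ (A⁻¹ *ᵥ q) = q := by rw [mulVec_mulVec, mul_nonsing_inv _ hdet, one_mulVec]
    have hφα : (A⁻¹ *ᵥ q) x = (A⁻¹ *ᵥ q) y := by
      have := congrFun (mulVec_comp_of_submatrix α hIα hqα) x
      rw [Function.comp_apply, hαx] at this
      exact this.symm
    obtain ⟨i, hi, hmax⟩ := exists_mem_forall_le_of_mulVec_eq hWs hW1 ht hφ (sum_midFlow x y Y)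
      (s := {x, y}) ⟨x, by simp⟩ fun i hi => by
        simp only [Set.mem_insert_iff, Set.mem_singleton_iff, not_or] at hi
        exact midFlow_nonpos Y hi.1 hi.2
    refine midFlow_dotProduct_nonneg X hφα fun j => ?_
    rcases hi with rfl | rfl
    · exact hmax j
    · rw [hφα]; exact hmax j
  have hdd : 0 ≤ d ⬝ᵥ A⁻¹ *ᵥ d := by
    simpa using hpd.inv.posSemidef.dotProduct_mulVec_nonneg d
  have hX := weightedLap_starWeight_sub hxX hyX
  have hY := weightedLap_starWeight_sub hxY hyY
  have hLW : weightedLap W = weightedLap H + (1 / 2 : ℝ) • (weightedLap (starWeight x X) +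
      weightedLap (starWeight y X) + weightedLap (starWeight x Y) +
      weightedLap (starWeight y Y)) := by
    rw [hW, hBα, hB]
    simp only [weightedLap_smul, weightedLap_add]
    module
  have e1 : t • (1 : Matrix V V ℝ) - weightedLap B =
      A + (-(1 / 2) : ℝ) • (vecMulVec (p - q) d + vecMulVec d (p - q)) := by
    have : vecMulVec (p - q) d + vecMulVec d (p - q) =
        (vecMulVec p d + vecMulVec d p) - (vecMulVec q d + vecMulVec d q) := by
      rw [sub_vecMulVec p q d, vecMulVec_sub d p q]; module
    rw [this, ← hX, ← hY, hA, hLW, hB]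
    simp only [weightedLap_add]
    module
  have e2 : t • (1 : Matrix V V ℝ) - weightedLap (H + starWeight y X + starWeight y Y) =
      A + (1 / 2 : ℝ) • (vecMulVec (p + q) d + vecMulVec d (p + q)) := by
    have : vecMulVec (p + q) d + vecMulVec d (p + q) =
        (vecMulVec p d + vecMulVec d p) + (vecMulVec q d + vecMulVec d q) := by
      rw [add_vecMulVec p q d, vecMulVec_add d p q]; module
    rw [this, ← hX, ← hY, hA, hLW]
    simp only [weightedLap_add]
    module
  have o1 : (p - q) ⬝ᵥ A⁻¹ *ᵥ d = 0 := by rw [sub_dotProduct, horth hpα, horth hqα, sub_zero]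
  have o2 : (p + q) ⬝ᵥ A⁻¹ *ᵥ d = 0 := by rw [add_dotProduct, horth hpα, horth hqα, add_zero]
  rw [e1, e2, det_add_smul_vecMulVec hdet _ o1 (hcomm _ _ ▸ o1),
    det_add_smul_vecMulVec hdet _ o2 (hcomm _ _ ▸ o2)]
  refine mul_le_mul_of_nonneg_left ?_ hpd.det_pos.le
  have hq' := hcomm q p
  simp only [sub_dotProduct, add_dotProduct, mulVec_sub, mulVec_add, dotProduct_sub,
    dotProduct_add, hq']
  -- By polarization, the two sides differ by exactly ⟨p, A⁻¹q⟩⟨d, A⁻¹d⟩.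
  nlinarith [mul_nonneg hpq hdd]

/-! ### Adjacency matrices as core plus stars. -/

section Graphs

variable {V : Type*} [Fintype V] [DecidableEq V]

omit [Fintype V] [DecidableEq V] in
theorem mk_mem_edgesTo {a i j : V} {S : Set V} :
    s(i, j) ∈ edgesTo a S ↔ (i = a ∧ j ∈ S) ∨ (j = a ∧ i ∈ S) := by
  simp only [edgesTo, Set.mem_ofPred_eq, Sym2.eq_iff]
  constructor
  · rintro ⟨v, hv, ⟨rfl, rfl⟩ | ⟨rfl, rfl⟩⟩
    · exact Or.inl ⟨rfl, hv⟩
    · exact Or.inr ⟨rfl, hv⟩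
  · rintro (⟨rfl, h⟩ | ⟨rfl, h⟩)
    · exact ⟨j, h, Or.inl ⟨rfl, rfl⟩⟩
    · exact ⟨i, h, Or.inr ⟨rfl, rfl⟩⟩

omit [Fintype V] [DecidableEq V] in
theorem mem_privateNeighbors {G : SimpleGraph V} {K : Set V} {x y v : V} :
    v ∈ privateNeighbors G K x y ↔ G.Adj x v ∧ v ∉ K ∧ ¬G.Adj y v := by
  simp [privateNeighbors]

omit [Fintype V] in
theorem adjMatrix_eq_kCore_add (G : SimpleGraph V) {K : Set V} {x y : V} (hxy : x ≠ y)
    (hxK : x ∈ K) (hyK : y ∈ K) [DecidableRel G.Adj] [DecidableRel (kCore G K x y).Adj]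
    {X Y : Finset V} (hX : ∀ v, v ∈ X ↔ v ∈ privateNeighbors G K x y)
    (hY : ∀ v, v ∈ Y ↔ v ∈ privateNeighbors G K y x) :
    G.adjMatrix ℝ = (kCore G K x y).adjMatrix ℝ + starWeight x X + starWeight y Y := by
  ext i j
  have hH : (kCore G K x y).Adj i j ↔ G.Adj i j ∧ ¬(((i = x ∧ j ∈ X) ∨ (j = x ∧ i ∈ X)) ∨
      ((i = y ∧ j ∈ Y) ∨ (j = y ∧ i ∈ Y))) := by
    simp only [kCore, SimpleGraph.deleteEdges_adj, Set.mem_union, mk_mem_edgesTo, hX, hY]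
  simp only [mem_privateNeighbors] at hX hY
  simp only [SimpleGraph.adjMatrix_apply, Matrix.add_apply, starWeight_apply, hH]
  have := G.adj_comm i j
  grind

-- `X` contains no neighbour of y, nor y itself as y ∈ K, so every edge of the moved star is new and
-- no entry is counted twice.
omit [Fintype V] in
theorem adjMatrix_kOp_eq (G : SimpleGraph V) {K : Set V} {x y : V} (hxy : x ≠ y)
    (hyK : y ∈ K) [DecidableRel (kOp G K x y).Adj]
    [DecidableRel (kCore G K x y).Adj]
    {X Y : Finset V} (hX : ∀ v, v ∈ X ↔ v ∈ privateNeighbors G K x y)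
    (hY : ∀ v, v ∈ Y ↔ v ∈ privateNeighbors G K y x) :
    (kOp G K x y).adjMatrix ℝ =
      (kCore G K x y).adjMatrix ℝ + starWeight y X + starWeight y Y := by
  classical
  ext i j
  have hH : (kCore G K x y).Adj i j ↔ G.Adj i j ∧ ¬(((i = x ∧ j ∈ X) ∨ (j = x ∧ i ∈ X)) ∨
      ((i = y ∧ j ∈ Y) ∨ (j = y ∧ i ∈ Y))) := by
    simp only [kCore, SimpleGraph.deleteEdges_adj, Set.mem_union, mk_mem_edgesTo, hX, hY]
  have hO : (kOp G K x y).Adj i j ↔ (G.Adj i j ∧ ¬((i = x ∧ j ∈ X) ∨ (j = x ∧ i ∈ X))) ∨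
      (((i = y ∧ j ∈ X) ∨ (j = y ∧ i ∈ X)) ∧ i ≠ j) := by
    simp only [kOp, SimpleGraph.sup_adj, SimpleGraph.deleteEdges_adj,
      SimpleGraph.fromEdgeSet_adj, mk_mem_edgesTo, hX]
  simp only [mem_privateNeighbors] at hX hY
  simp only [SimpleGraph.adjMatrix_apply, Matrix.add_apply, starWeight_apply, hH, hO]
  have := G.adj_comm i j
  grind

theorem mul_eval_laplacianPoly [Nonempty V] (G : SimpleGraph V) [DecidableRel G.Adj] (t : ℝ) :
    t * (laplacianPoly G).eval t =
      (t • (1 : Matrix V V ℝ) - weightedLap (G.adjMatrix ℝ)).det := by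
  rw [weightedLap_adjMatrix, smul_one_eq_diagonal, ← scalar_apply, ← eval_charpoly,
    ← X_mul_laplacianPoly, eval_mul, eval_X]

theorem eval_laplacianPoly_kOp_le (G : SimpleGraph V) {K : Set V} {x y : V} (hxy : x ≠ y)
    (hxK : x ∈ K) (hyK : y ∈ K) (h : IsSymmetricKOp G K x y) {t : ℝ}
    (ht : (Fintype.card V : ℝ) < t) :
    (laplacianPoly (kOp G K x y)).eval t ≤ (laplacianPoly G).eval t := by
  classical
  have : Nonempty V := ⟨x⟩
  obtain ⟨α, hαx, hαy, -, hfix⟩ := h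
  have hX (v : V) : v ∈ (privateNeighbors G K x y).toFinset ↔ v ∈ privateNeighbors G K x y :=
    Set.mem_toFinset
  have hY (v : V) : v ∈ (privateNeighbors G K y x).toFinset ↔ v ∈ privateNeighbors G K y x :=
    Set.mem_toFinset
  have hG := adjMatrix_eq_kCore_add G hxy hxK hyK hX hY
  have hG' := adjMatrix_kOp_eq G hxy hyK hX hY
  have hK {a b v : V} (hv : v ∈ K) : v ∉ (privateNeighbors G K a b).toFinset := fun hmem =>
    (Set.mem_toFinset.mp hmem).2 (Or.inl hv)
  have ht0 : (0 : ℝ) < t := lt_of_le_of_lt (Nat.cast_nonneg _) ht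
  refine le_of_mul_le_mul_left ?_ ht0
  rw [mul_eval_laplacianPoly, mul_eval_laplacianPoly, hG, hG']
  refine det_le_det_of_symmetric_stars (SimpleGraph.isSymm_adjMatrix _) (hK hxK) (hK hyK)
    (hK hxK) (hK hyK) α.toEquiv ?_ hαx hαy (fun v hv => hfix v (Or.inl ((hX v).mp hv)))
    (fun v hv => hfix v (Or.inr ((hY v).mp hv))) (fun i j => ?_) ht
  · ext i j
    simp [SimpleGraph.adjMatrix_apply, α.map_adj_iff]
  · rw [← hG, SimpleGraph.adjMatrix_apply]
    split_ifs <;> norm_num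

end Graphs

end LaplacianPosets

theorem mainTheorem2 {V : Type*} [Fintype V] (G G' : SimpleGraph V)
    (h : LaplacianPosets.ObtainedBySymmetricKOp G G') :
    LaplacianPosets.PGe G G' := by
  classical
  obtain ⟨K, x, y, hxy, hxK, hyK, hsymm, rfl⟩ := h
  refine ⟨le_rfl, rfl, fun t ht => ?_⟩
  -- Positive definiteness needs t > n strictly, so the endpoint t = n is reached as a limit from
  -- the right.
  have hcont (p : Polynomial ℝ) :
      Filter.Tendsto (fun s => p.eval s) (nhdsWithin t (Set.Ioi t)) (nhds (p.eval t)) :=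
    p.continuous.continuousAt.tendsto.mono_left nhdsWithin_le_nhds
  refine le_of_tendsto_of_tendsto (hcont _) (hcont _) ?_
  filter_upwards [self_mem_nhdsWithin] with s hs
  exact LaplacianPosets.eval_laplacianPoly_kOp_le G hxy hxK hyK hsymm (lt_of_le_of_lt ht hs)
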